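/- Let $b\in\mathbb R$ (the product $b=\beta h$ of inverse temperature and external field, kept fixed as an independent parameter), $x\ge0$, $t\ge0$. For $N\ge1$ let $J_{ij}$ ($1\le i<j\le N$) and $J_i$ ($1\le i\le N$) be independent standard Gaussian random variables, let $E$ denote expectation over them, and for $\sigma\in\{-1,1\}^N$ set $$\mathcal E_{x,t}(\sigma)=\sqrt{\tfrac tN}\sum_{i<j}J_{ij}\sigma_i\sigma_j+b\sum_i\sigma_i+\sqrt x\sum_iJ_i\sigma_i,\qquad Z_N(x,t)=\sum_{\sigma}e^{\mathcal E_{x,t}(\sigma)},\qquad \alpha_N(x,t)=\frac1N E\log Z_N(x,t).$$ Let $\mu$ be the standard Gaussian measure on $\mathbb R$ and, for $x_0\ge0$, $\bar q(x_0)=\int\tanh^2(b+z\sqrt{x_0})\,d\mu(z)$. Let $x_0(x,t)$ be the solution $x_0\ge0$ of $x=x_0-\bar q(x_0)\,t$ (the largest one, if there are several, as happens only for $b=0$, $x=0$, $t>1$), let $\bar q(x,t)=\bar q(x_0(x,t))$, and let $$\bar\alpha(x,t)=\log2+\int\log\cosh\bigl(b+z\sqrt{x_0}\bigr)\,d\mu(z)+\frac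 t4\bigl(1-\bar q(x_0)\bigr)^2,\qquad x_0=x_0(x,t),$$ be the replica-symmetric Sherrington–Kirkpatrick value. With the overlap $q_{12}(\sigma,\sigma')=\frac1N\sum_i\sigma_i\sigma'_i$, define for $\lambda\ge0$ $$\tilde\alpha_N(x,\lambda,t)=\frac1{2N}E\log\sum_{\sigma,\sigma'}\exp\Bigl(\mathcal E_{x,t}(\sigma)+\mathcal E_{x,t}(\sigma')+\frac\lambda2N\bigl(q_{12}(\sigma,\sigma')-\bar q(x,t)\bigr)^2\Bigr),$$ $\Delta_N(x_0,\lambda_0)=\tilde\alpha_N(x_0,\lambda_0,0)-\alpha_N(x_0,0)$, and let $\lambda_c(x_0)\in[0,\infty]$ be the supremum of all $r\ge0$ such that $\lim_{N\to\infty}\Delta_N(x_0,\lambda_0)=0$ for every $0\le\lambda_0\le r$. Theorem. For all $b\in\mathbb R$, $x\ge0$ and $t\ge0$ with $t\le\lambda_c(x_0(x,t))$, $$\lim_{N\to\infty}\alpha_N(x,t)=\bar\alpha(x,t).$$ -/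

import Mathlib

open MeasureTheory ProbabilityTheory Filter Topology

noncomputable section

namespace SK

/-- Configurations of `N` Ising spins; the value of a spin is `spin (σ i)`. -/
abbrev Config (N : ℕ) : Type := Fin N → Bool

/-- The value `±1` of an Ising spin. -/
def spin (s : Bool) : ℝ := if s then 1 else -1

/-- The couples of sites `(i, j)`, each couple being listed once, with `i < j`. -/
abbrev Couple (N : ℕ) : Type := {p : Fin N × Fin N // p.1 < p.2}

/-- A sample of the quenched disorder: `J (Sum.inl (i, j))` is the coupling `J_{ij}`, `i < j`,
and `J (Sum.inr i)` is the one-body random field `J_i`. -/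
abbrev Disorder (N : ℕ) : Type := (Couple N ⊕ Fin N) → ℝ

/-- The law of the disorder: all the `J_{ij}` and `J_i` are independent centered unit Gaussians. -/
def disorderLaw (N : ℕ) : Measure (Disorder N) := Measure.pi fun _ => gaussianReal 0 1

/-- The exponent of the Boltzmann factor,
`√(t/N) ∑_{(i,j)} J_{ij} σ_i σ_j + b ∑_i σ_i + √x ∑_i J_i σ_i`.
The parameter `b` is the product `β h` of the inverse temperature and the external field. -/
def energy (N : ℕ) (b x t : ℝ) (J : Disorder N) (σ : Config N) : ℝ :=
  √(t / N) * ∑ p : Couple N, J (Sum.inl p) * spin (σ p.1.1) * spin (σ p.1.2)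
    + b * ∑ i, spin (σ i) + √x * ∑ i, J (Sum.inr i) * spin (σ i)

/-- The partition function `Z_N`. -/
def partition (N : ℕ) (b x t : ℝ) (J : Disorder N) : ℝ :=
  ∑ σ : Config N, Real.exp (energy N b x t J σ)

/-- `α_N(x,t) = N⁻¹ E log Z_N`. -/
def alpha (N : ℕ) (b x t : ℝ) : ℝ :=
  (N : ℝ)⁻¹ * ∫ J, Real.log (partition N b x t J) ∂(disorderLaw N)

/-- The order parameter at `t = 0`: `q̄(x₀) = ∫ tanh²(b + z √x₀) dμ(z)`. -/
def qbar (b x₀ : ℝ) : ℝ := ∫ z, Real.tanh (b + z * √x₀) ^ 2 ∂(gaussianReal 0 1)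

/-- `x₀` is the starting point of a trajectory `s ↦ x₀ - q̄(x₀) s` that is at `x` at time `t`. -/
def IsStart (b x t x₀ : ℝ) : Prop := 0 ≤ x₀ ∧ x = x₀ - qbar b x₀ * t

/-- The starting point `x₀(x,t)` of the trajectory through `(x,t)`. The trajectory is unique
except when `b = 0`, `x = 0`, `t > 1`, where besides the trivial `x₀ = 0` there is a
starting point `x₀ > 0`, and the latter is meant; taking the supremum covers all cases. -/
def start (b x t : ℝ) : ℝ := sSup {x₀ | IsStart b x t x₀}

/-- `q̄(x,t) = q̄(x₀(x,t))`. -/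
def qbarAt (b x t : ℝ) : ℝ := qbar b (start b x t)

/-- The replica symmetric Sherrington-Kirkpatrick solution
`ᾱ(x,t) = log 2 + ∫ log cosh(b + z √x₀) dμ(z) + (t/4) (1 - q̄(x₀))²`, with `x₀ = x₀(x,t)`. -/
def alphaBar (b x t : ℝ) : ℝ :=
  Real.log 2 + ∫ z, Real.log (Real.cosh (b + z * √(start b x t))) ∂(gaussianReal 0 1)
    + t / 4 * (1 - qbar b (start b x t)) ^ 2

/-- The overlap of two configurations. -/
def overlap (N : ℕ) (σ τ : Config N) : ℝ := (N : ℝ)⁻¹ * ∑ i, spin (σ i) * spin (τ i)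

/-- The partition function `Z̃_N` of two replicas with the same disorder, coupled by the term
`(lam/2) N (q₁₂ - q̄(x,t))²`. -/
def coupledPartition (N : ℕ) (b x lam t : ℝ) (J : Disorder N) : ℝ :=
  ∑ σ : Config N, ∑ τ : Config N,
    Real.exp (energy N b x t J σ + energy N b x t J τ
      + lam / 2 * N * (overlap N σ τ - qbarAt b x t) ^ 2)

/-- `α̃_N(x,lam,t) = (2N)⁻¹ E log Z̃_N`. -/
def coupledAlpha (N : ℕ) (b x lam t : ℝ) : ℝ :=
  (2 * (N : ℝ))⁻¹ * ∫ J, Real.log (coupledPartition N b x lam t J) ∂(disorderLaw N)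

/-- `Δ_N(x₀,lam₀) = α̃_N(x₀,lam₀,0) - α_N(x₀,0)`. -/
def Delta (N : ℕ) (b x₀ lam₀ : ℝ) : ℝ := coupledAlpha N b x₀ lam₀ 0 - alpha N b x₀ 0

/-- The threshold `λ_c(x₀)`: the supremum of the `r ≥ 0` such that `Δ_N(x₀,lam₀) → 0` as
`N → ∞` for every `0 ≤ lam₀ ≤ r`. -/
def lambdaC (b x₀ : ℝ) : EReal :=
  ⨆ r ∈ {r : ℝ | 0 ≤ r ∧ ∀ lam₀ : ℝ, 0 ≤ lam₀ → lam₀ ≤ r →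
    Tendsto (fun N : ℕ => Delta N b x₀ lam₀) atTop (𝓝 0)}, (r : EReal)

theorem abs_tanh_sq_le (y : ℝ) : |Real.tanh y ^ 2| ≤ 1 := by
  rw [abs_of_nonneg (sq_nonneg _), sq_le_one_iff_abs_le_one]
  exact abs_le.2 ⟨(Real.neg_one_lt_tanh y).le, (Real.tanh_lt_one y).le⟩

theorem continuous_tanh : Continuous Real.tanh := by
  have : Real.tanh = fun y => Real.sinh y / Real.cosh y := funext Real.tanh_eq_sinh_div_cosh
  rw [this]
  exact Real.continuous_sinh.div Real.continuous_cosh fun y => (Real.cosh_pos y).ne'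

theorem continuous_qbar (b : ℝ) : Continuous (qbar b) := by
  unfold qbar
  refine continuous_of_dominated (bound := fun _ => 1) ?_ ?_ (integrable_const _) ?_
  · intro y
    exact ((continuous_tanh.comp (by fun_prop)).pow 2).aestronglyMeasurable
  · intro y
    exact Eventually.of_forall fun z => abs_tanh_sq_le _
  · exact Eventually.of_forall fun z => (continuous_tanh.comp (by fun_prop)).pow 2

theorem qbar_nonneg (b y : ℝ) : 0 ≤ qbar b y := integral_nonneg fun _ => sq_nonneg _

theorem qbar_le_one (b y : ℝ) : qbar b y ≤ 1 := by
  have h := norm_integral_le_of_norm_le_const (μ := gaussianReal 0 1) (C := 1)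
    (f := fun z => Real.tanh (b + z * √y) ^ 2) (Eventually.of_forall fun z => abs_tanh_sq_le _)
  simpa [qbar] using (le_abs_self _).trans h

/-- The starting point is well defined: the equation of the trajectory has a solution, and
`start b x t` is its largest solution (the solution, where it is unique). -/
theorem isGreatest_start (b x t : ℝ) (hx : 0 ≤ x) (ht : 0 ≤ t) :
    IsGreatest {x₀ | IsStart b x t x₀} (start b x t) := by
  have hc : Continuous fun y => y - qbar b y * t :=
    continuous_id.sub ((continuous_qbar b).mul continuous_const)
  have hne : {x₀ | IsStart b x t x₀}.Nonempty := by
    have h := intermediate_value_Icc (a := 0) (b := x + t) (by positivity) hc.continuousOn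
    have hmem : x ∈ Set.Icc (0 - qbar b 0 * t) (x + t - qbar b (x + t) * t) := by
      constructor
      · nlinarith [mul_nonneg (qbar_nonneg b 0) ht]
      · nlinarith [mul_le_mul_of_nonneg_right (qbar_le_one b (x + t)) ht]
    obtain ⟨y, hy, hyx⟩ := h hmem
    exact ⟨y, hy.1, hyx.symm⟩
  have hbd : BddAbove {x₀ | IsStart b x t x₀} := by
    refine ⟨x + t, fun y hy => ?_⟩
    nlinarith [hy.2, mul_le_mul_of_nonneg_right (qbar_le_one b y) ht]
  have hcl : IsClosed {x₀ | IsStart b x t x₀} :=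
    (isClosed_le continuous_const continuous_id).inter (isClosed_eq continuous_const hc)
  exact ⟨hcl.csSup_mem hne hbd, fun y hy => le_csSup hbd hy⟩

end SK

end

noncomputable section

namespace SK

/-! ### Gaussian integration by parts -/

/-! The argument is a quadratic coupling of two replicas. Fix `x₀` and `m = qbar b x₀`, and follow
the trajectory `u ↦ (x₀ - m u, u)`. Gaussian integration by parts (`hasDerivAt_freeEnergy_replicas`)
expresses the derivative of `alpha` through overlaps; the falling field strength completes the
square (`sum_rate_monomial`), giving `(1 - m)² / 4 - ⟨(q₁₂ - m)²⟩ / 4`. At `u = 0` the spins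
decouple, so the replica symmetric value is the initial value plus the integral of the first term.
The `gap` to it therefore starts at `0` and grows at a quarter of the mean square deviation of the
overlap.

To control this deviation, couple the replicas by `(lam / 2) N (q₁₂ - m)²`. Jensen's inequality
bounds `lam / 2` times the deviation by the gain in coupled free energy per site
(`meanSqDev_le_coupledFreeEnergy`). When `lam = lam₀ - u` falls at unit speed, the only squares of
positive sign cancel, and the coupled free energy grows no faster than `u (N / 2) (1 - m)²`
(`exists_hasDerivAt_coupledFreeEnergy_path`). With `δ = Delta N b x₀ lam₀` this reads `(lam₀ - u)
gap' ≤ δ + gap`, that is `((lam₀ - u) gap)' ≤ δ`, whence `(lam₀ - T) gap(T) ≤ T δ`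
(`sub_mul_gap_le`).

Below the threshold some `lam₀ > T` has `δ → 0`. The threshold itself is reached because the gap
grows at rate at most `1`, uniformly in `N` (`tendsto_gap`). -/

theorem hasDerivAt_gaussianPDFReal_zero_one (z : ℝ) :
    HasDerivAt (gaussianPDFReal 0 1) (-(z * gaussianPDFReal 0 1 z)) z := by
  have h : HasDerivAt (fun y : ℝ => -(y - 0) ^ 2 / (2 * ((1 : NNReal) : ℝ))) (-z) z := by
    have := (((hasDerivAt_id z).sub_const 0).pow 2).neg.div_const (2 * ((1 : NNReal) : ℝ))
    convert! this using 1
    simp [neg_div]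
  rw [gaussianPDFReal_def]
  convert! h.exp.const_mul (√(2 * Real.pi * ((1 : NNReal) : ℝ)))⁻¹ using 1
  ring

theorem integrable_gaussianReal_iff {f : ℝ → ℝ} :
    Integrable f (gaussianReal 0 1) ↔ Integrable (fun z => gaussianPDFReal 0 1 z * f z) := by
  rw [gaussianReal_of_var_ne_zero 0 one_ne_zero,
    integrable_withDensity_iff_integrable_smul' (measurable_gaussianPDF 0 1)
      (Eventually.of_forall fun _ => gaussianPDF_lt_top)]
  simp [toReal_gaussianPDF]

theorem integrable_id_gaussianReal : Integrable (fun z : ℝ => z) (gaussianReal 0 1) :=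
  memLp_one_iff_integrable.1 (memLp_id_gaussianReal (μ := 0) (v := 1) 1)

/-- Stein's identity for the standard Gaussian measure on `ℝ`. -/
theorem integral_id_mul_gaussianReal {f f' : ℝ → ℝ} (hf : ∀ z, HasDerivAt f (f' z) z)
    (hfb : ∃ C, ∀ z, |f z| ≤ C) (hf' : Integrable f' (gaussianReal 0 1)) :
    ∫ z, z * f z ∂(gaussianReal 0 1) = ∫ z, f' z ∂(gaussianReal 0 1) := by
  obtain ⟨C, hC⟩ := hfb
  have hfm : AEStronglyMeasurable f (gaussianReal 0 1) :=
    (continuous_iff_continuousAt.2 fun z => (hf z).continuousAt).aestronglyMeasurable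
  have hfi : Integrable f (gaussianReal 0 1) :=
    Integrable.of_bound hfm C (Eventually.of_forall hC)
  have hzf : Integrable (fun z => z * f z) (gaussianReal 0 1) :=
    integrable_id_gaussianReal.mul_bdd hfm (Eventually.of_forall hC)
  rw [integrable_gaussianReal_iff] at hfi hzf hf'
  have h := integral_mul_deriv_eq_deriv_mul_of_integrable (u := f) (u' := f')
    (v := gaussianPDFReal 0 1) (v' := fun z => -(z * gaussianPDFReal 0 1 z))
    (fun z _ => hf z) (fun z _ => hasDerivAt_gaussianPDFReal_zero_one z)
    (hzf.neg.congr (Eventually.of_forall fun z => by simp; ring))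
    (hf'.congr (Eventually.of_forall fun z => by simp; ring))
    (hfi.congr (Eventually.of_forall fun z => by simp; ring))
  rw [integral_gaussianReal_eq_integral_smul one_ne_zero,
    integral_gaussianReal_eq_integral_smul one_ne_zero]
  simp only [smul_eq_mul]
  calc ∫ z, gaussianPDFReal 0 1 z * (z * f z)
      = -∫ z, f z * -(z * gaussianPDFReal 0 1 z) := by
        rw [← integral_neg]; congr 1; ext z; ring
    _ = ∫ z, f' z * gaussianPDFReal 0 1 z := by rw [h, neg_neg]
    _ = _ := by congr 1; ext z; ring

/-! ### Integration by parts for finitely many Gaussian variables. -/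

section Pi

variable {I : Type*} [Fintype I]

/-- The standard Gaussian measure on `ℝ^I`. -/
abbrev stdGauss (I : Type*) [Fintype I] : Measure (I → ℝ) := Measure.pi fun _ => gaussianReal 0 1

/-- Resampling one coordinate preserves the standard Gaussian measure. -/
theorem measurePreserving_update [DecidableEq I] (k : I) :
    MeasurePreserving (fun p : (I → ℝ) × ℝ => Function.update p.1 k p.2)
      ((stdGauss I).prod (gaussianReal 0 1)) (stdGauss I) := by
  have hm : Measurable (fun p : (I → ℝ) × ℝ => Function.update p.1 k p.2) := by
    rw [measurable_pi_iff]
    intro i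
    by_cases h : i = k
    · subst h; simpa using measurable_snd
    · simp only [Function.update_of_ne h]
      exact (measurable_pi_apply i).comp measurable_fst
  refine ⟨hm, (Measure.pi_eq fun s hs => ?_).symm⟩
  rw [Measure.map_apply hm (MeasurableSet.univ_pi hs)]
  have : (fun p : (I → ℝ) × ℝ => Function.update p.1 k p.2) ⁻¹' Set.univ.pi s
      = (Set.univ.pi (Function.update s k Set.univ)) ×ˢ s k := by
    ext p
    simp only [Set.mem_preimage, Set.mem_pi, Set.mem_univ, true_implies, Set.mem_prod]
    constructor
    · intro h
      refine ⟨fun i => ?_, by simpa using h k⟩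
      by_cases hi : i = k
      · subst hi; simp
      · simpa [Function.update_of_ne hi] using h i
    · rintro ⟨h1, h2⟩ i
      by_cases hi : i = k
      · subst hi; simpa using h2
      · simpa [Function.update_of_ne hi] using h1 i
  rw [this, Measure.prod_prod, Measure.pi_pi, ← Finset.mul_prod_erase _ _ (Finset.mem_univ k),
    ← Finset.mul_prod_erase (a := k) Finset.univ (fun i => gaussianReal 0 1 (s i))
      (Finset.mem_univ k), mul_comm]
  simp only [Function.update_self, measure_univ, one_mul]
  congr 1
  refine Finset.prod_congr rfl fun i hi => ?_
  rw [Function.update_of_ne (Finset.ne_of_mem_erase hi)]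

theorem integrable_eval_stdGauss (k : I) : Integrable (fun J : I → ℝ => J k) (stdGauss I) :=
  integrable_comp_eval (μ := fun _ : I => gaussianReal 0 1) (i := k) (f := fun z : ℝ => z)
    integrable_id_gaussianReal

/-- Gaussian integration by parts in one coordinate of `ℝ^I`. -/
theorem integral_eval_mul_stdGauss [DecidableEq I] (k : I) {f f' : (I → ℝ) → ℝ}
    (hfc : Continuous f) (hfc' : Continuous f') {C C' : ℝ} (hfb : ∀ J, |f J| ≤ C)
    (hfb' : ∀ J, |f' J| ≤ C')
    (hf : ∀ J z, HasDerivAt (fun y => f (Function.update J k y)) (f' (Function.update J k z)) z) :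
    ∫ J, J k * f J ∂(stdGauss I) = ∫ J, f' J ∂(stdGauss I) := by
  have hmp := measurePreserving_update k
  have h1 : Integrable (fun J : I → ℝ => J k * f J) (stdGauss I) :=
    (integrable_eval_stdGauss k).mul_bdd hfc.aestronglyMeasurable (Eventually.of_forall hfb)
  have h2 : Integrable f' (stdGauss I) :=
    Integrable.of_bound hfc'.aestronglyMeasurable C' (Eventually.of_forall hfb')
  rw [← hmp.map_eq] at h1 h2
  have e1 := integral_map hmp.measurable.aemeasurable h1.aestronglyMeasurable
  have e2 := integral_map hmp.measurable.aemeasurable h2.aestronglyMeasurable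
  have i1 := h1.comp_measurable hmp.measurable
  have i2 := h2.comp_measurable hmp.measurable
  rw [hmp.map_eq] at e1 e2
  rw [e1, e2]
  -- Fubini: with the other coordinates frozen, this is the one-dimensional identity in the
  -- resampled one.
  refine (integral_prod _ i1).trans (Eq.trans ?_ (integral_prod _ i2).symm)
  congr 1
  ext J
  simp only [Function.comp_apply, Function.update_self]
  refine integral_id_mul_gaussianReal (hf J) ⟨C, fun z => hfb _⟩ ?_
  exact Integrable.of_bound (hfc'.comp (by fun_prop)).aestronglyMeasurable C'
    (Eventually.of_forall fun z => hfb' _)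

end Pi

/-! ### Gibbs averages -/

section Gibbs

variable {A : Type*} [Fintype A]

/-- The partition function of the Boltzmann weights `exp (H a)`. -/
def gibbsZ (H : A → ℝ) : ℝ := ∑ a, Real.exp (H a)

/-- The average of `f` for the Boltzmann weights `exp (H a)`. -/
def gibbsAvg (H f : A → ℝ) : ℝ := (∑ a, f a * Real.exp (H a)) / gibbsZ H

theorem gibbsZ_pos [Nonempty A] (H : A → ℝ) : 0 < gibbsZ H :=
  Finset.sum_pos (fun _ _ => Real.exp_pos _) Finset.univ_nonempty

theorem gibbsAvg_const [Nonempty A] (H : A → ℝ) (r : ℝ) : gibbsAvg H (fun _ => r) = r := by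
  rw [gibbsAvg, ← Finset.mul_sum]
  exact mul_div_cancel_right₀ r (gibbsZ_pos H).ne'

theorem gibbsAvg_add (H f g : A → ℝ) :
    gibbsAvg H (fun a => f a + g a) = gibbsAvg H f + gibbsAvg H g := by
  simp only [gibbsAvg, add_mul, Finset.sum_add_distrib, add_div]

theorem gibbsAvg_const_mul (H f : A → ℝ) (r : ℝ) :
    gibbsAvg H (fun a => r * f a) = r * gibbsAvg H f := by
  simp only [gibbsAvg, mul_assoc, ← Finset.mul_sum, mul_div_assoc]

theorem gibbsAvg_sum {I : Type*} (s : Finset I) (H : A → ℝ) (f : I → A → ℝ) :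
    gibbsAvg H (fun a => ∑ k ∈ s, f k a) = ∑ k ∈ s, gibbsAvg H (f k) := by
  simp only [gibbsAvg, Finset.sum_mul, ← Finset.sum_div]
  rw [Finset.sum_comm]

theorem gibbsAvg_mono [Nonempty A] (H : A → ℝ) {f g : A → ℝ} (h : ∀ a, f a ≤ g a) :
    gibbsAvg H f ≤ gibbsAvg H g := by
  unfold gibbsAvg
  have := gibbsZ_pos H
  gcongr with a
  exact h a

theorem gibbsAvg_nonneg [Nonempty A] (H : A → ℝ) {f : A → ℝ} (h : ∀ a, 0 ≤ f a) :
    0 ≤ gibbsAvg H f := by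
  simpa [gibbsAvg_const] using gibbsAvg_mono H (f := fun _ => 0) h

theorem abs_gibbsAvg_le [Nonempty A] (H : A → ℝ) {f : A → ℝ} {C : ℝ} (h : ∀ a, |f a| ≤ C) :
    |gibbsAvg H f| ≤ C := by
  rw [abs_le]
  constructor
  · simpa [gibbsAvg_const] using
      gibbsAvg_mono H (f := fun _ => -C) (g := f) fun a => (abs_le.1 (h a)).1
  · simpa [gibbsAvg_const] using
      gibbsAvg_mono H (g := fun _ => C) (f := f) fun a => (abs_le.1 (h a)).2

theorem continuous_gibbsZ : Continuous (gibbsZ : (A → ℝ) → ℝ) := by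
  unfold gibbsZ
  fun_prop

theorem continuous_log_gibbsZ [Nonempty A] :
    Continuous (fun H : A → ℝ => Real.log (gibbsZ H)) :=
  continuous_gibbsZ.log fun H => (gibbsZ_pos H).ne'

theorem continuous_gibbsAvg [Nonempty A] (f : A → ℝ) :
    Continuous (fun H : A → ℝ => gibbsAvg H f) := by
  unfold gibbsAvg
  refine Continuous.div ?_ continuous_gibbsZ fun H => (gibbsZ_pos H).ne'
  fun_prop

theorem hasDerivAt_gibbsZ {H : ℝ → A → ℝ} {H' : A → ℝ} {s : ℝ}
    (h : ∀ a, HasDerivAt (fun u => H u a) (H' a) s) :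
    HasDerivAt (fun u => gibbsZ (H u)) (∑ a, H' a * Real.exp (H s a)) s := by
  unfold gibbsZ
  refine HasDerivAt.fun_sum fun a _ => ?_
  simpa [mul_comm] using (h a).exp

theorem hasDerivAt_log_gibbsZ [Nonempty A] {H : ℝ → A → ℝ} {H' : A → ℝ} {s : ℝ}
    (h : ∀ a, HasDerivAt (fun u => H u a) (H' a) s) :
    HasDerivAt (fun u => Real.log (gibbsZ (H u))) (gibbsAvg (H s) H') s :=
  (hasDerivAt_gibbsZ h).log (gibbsZ_pos _).ne'

/-- The response of a Gibbs average is a covariance; this is how integration by parts produces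
thermal variances. -/
theorem hasDerivAt_gibbsAvg [Nonempty A] {H : ℝ → A → ℝ} {H' : A → ℝ} {s : ℝ} (f : A → ℝ)
    (h : ∀ a, HasDerivAt (fun u => H u a) (H' a) s) :
    HasDerivAt (fun u => gibbsAvg (H u) f)
      (gibbsAvg (H s) (fun a => f a * H' a) - gibbsAvg (H s) f * gibbsAvg (H s) H') s := by
  have h1 : HasDerivAt (fun u => ∑ a, f a * Real.exp (H u a))
      (∑ a, f a * H' a * Real.exp (H s a)) s := by
    refine HasDerivAt.fun_sum fun a _ => ?_
    convert! (h a).exp.const_mul (f a) using 1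
    ring
  have h2 := h1.div (hasDerivAt_gibbsZ h) (gibbsZ_pos _).ne'
  refine h2.congr_deriv ?_
  have := (gibbsZ_pos (H s)).ne'
  unfold gibbsAvg
  field_simp

/-- Jensen's inequality for Boltzmann weights. -/
theorem gibbsAvg_le_log_gibbsZ_sub [Nonempty A] (H g : A → ℝ) :
    gibbsAvg H g ≤ Real.log (gibbsZ fun a => H a + g a) - Real.log (gibbsZ H) := by
  have hZ := gibbsZ_pos H
  set m := gibbsAvg H g with hm
  -- Average `exp (g - m) ≥ 1 + (g - m)`: the linear term vanishes because `m` is the mean of `g`.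
  have key : Real.exp m * gibbsZ H ≤ gibbsZ fun a => H a + g a := by
    have h1 : ∑ a, (g a - m) * Real.exp (H a) = 0 := by
      simp only [sub_mul, Finset.sum_sub_distrib, ← Finset.mul_sum]
      rw [hm, gibbsAvg]
      change _ - _ / gibbsZ H * gibbsZ H = 0
      field_simp
      simp
    calc Real.exp m * gibbsZ H
        = Real.exp m * (gibbsZ H + ∑ a, (g a - m) * Real.exp (H a)) := by rw [h1, add_zero]
      _ = ∑ a, Real.exp m * ((g a - m + 1) * Real.exp (H a)) := by
        rw [gibbsZ, ← Finset.sum_add_distrib, Finset.mul_sum]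
        exact Finset.sum_congr rfl fun a _ => by ring
      _ ≤ _ := by
        refine Finset.sum_le_sum fun a _ => ?_
        calc Real.exp m * ((g a - m + 1) * Real.exp (H a))
            ≤ Real.exp m * (Real.exp (g a - m) * Real.exp (H a)) := by
              gcongr; exact Real.add_one_le_exp _
          _ = Real.exp (H a + g a) := by
              rw [← Real.exp_add, ← Real.exp_add]; congr 1; ring
  have h2 := Real.log_le_log (by positivity) key
  rw [Real.log_mul (Real.exp_pos _).ne' hZ.ne', Real.log_exp] at h2
  linarith

/-- Log-sum-exp is 1-Lipschitz in the sup norm. This supplies every domination needed below: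
integrability, continuity and differentiation under the integral. -/
theorem abs_log_gibbsZ_sub_le [Nonempty A] {H K : A → ℝ} {C : ℝ} (h : ∀ a, |H a - K a| ≤ C) :
    |Real.log (gibbsZ H) - Real.log (gibbsZ K)| ≤ C := by
  have key : ∀ H K : A → ℝ, (∀ a, |H a - K a| ≤ C) →
      Real.log (gibbsZ K) - Real.log (gibbsZ H) ≤ C := by
    intro H K h
    have h1 := gibbsAvg_le_log_gibbsZ_sub K (fun a => H a - K a)
    have h2 := abs_le.1 (abs_gibbsAvg_le K h)
    simp only [add_sub_cancel] at h1
    linarith [h2.1]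
  rw [abs_sub_le_iff]
  exact ⟨key K H fun a => by rw [abs_sub_comm]; exact h a, key H K h⟩

theorem gibbsZ_prod {B : Type*} [Fintype B] (H : A → ℝ) (K : B → ℝ) :
    gibbsZ (fun p : A × B => H p.1 + K p.2) = gibbsZ H * gibbsZ K := by
  simp only [gibbsZ, Real.exp_add, Fintype.sum_prod_type, Finset.sum_mul_sum]

theorem gibbsAvg_prod {B : Type*} [Fintype B] (H : A → ℝ) (K : B → ℝ) (f : A → ℝ) (g : B → ℝ) :
    gibbsAvg (fun p : A × B => H p.1 + K p.2) (fun p => f p.1 * g p.2)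
      = gibbsAvg H f * gibbsAvg K g := by
  unfold gibbsAvg
  rw [gibbsZ_prod, div_mul_div_comm, Finset.sum_mul_sum, Fintype.sum_prod_type]
  simp only [Real.exp_add]
  congr 1
  exact Finset.sum_congr rfl fun a _ => Finset.sum_congr rfl fun b _ => by ring

end Gibbs

/-! ### Free energies of Gaussian Hamiltonians -/

section FreeEnergy

variable {A I : Type*} [Fintype I]

/-- The Hamiltonian `∑ k, c k * J k * a σ k + h σ`, with disorder `J`. -/
def ham (c : I → ℝ) (a : A → I → ℝ) (h : A → ℝ) (J : I → ℝ) (σ : A) : ℝ :=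
  ∑ k, c k * J k * a σ k + h σ

theorem continuous_ham (c : I → ℝ) (a : A → I → ℝ) (h : A → ℝ) : Continuous (ham c a h) := by
  unfold ham
  fun_prop

theorem abs_ham_sub_le {a : A → I → ℝ} {B : ℝ} (hB : ∀ σ k, |a σ k| ≤ B) (c c' : I → ℝ)
    {h h' : A → ℝ} {D : ℝ} (hD : ∀ σ, |h σ - h' σ| ≤ D) (J : I → ℝ) (σ : A) :
    |ham c a h J σ - ham c' a h' J σ| ≤ ∑ k, |c k - c' k| * |J k| * B + D := by
  have : ham c a h J σ - ham c' a h' J σ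
      = ∑ k, (c k - c' k) * J k * a σ k + (h σ - h' σ) := by
    simp only [ham, sub_mul, Finset.sum_sub_distrib]; ring
  rw [this]
  refine (abs_add_le _ _).trans (add_le_add ((Finset.abs_sum_le_sum_abs _ _).trans ?_) (hD σ))
  refine Finset.sum_le_sum fun k _ => ?_
  rw [abs_mul, abs_mul]
  exact mul_le_mul_of_nonneg_left (hB σ k) (by positivity)

theorem integrable_sum_abs (r : I → ℝ) (B D : ℝ) :
    Integrable (fun J : I → ℝ => ∑ k, r k * |J k| * B + D) (stdGauss I) :=
  (integrable_finsetSum _ fun k _ =>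
    (((integrable_eval_stdGauss k).abs).const_mul _).mul_const _).add (integrable_const _)

variable [Fintype A]

/-- The quenched average of the logarithm of the partition function. -/
def freeEnergy (c : I → ℝ) (a : A → I → ℝ) (h : A → ℝ) : ℝ :=
  ∫ J, Real.log (gibbsZ (ham c a h J)) ∂(stdGauss I)

theorem exists_abs_le_matrix (a : A → I → ℝ) : ∃ B, 0 ≤ B ∧ ∀ σ k, |a σ k| ≤ B := by
  refine ⟨∑ σ, ∑ k, |a σ k|, by positivity, fun σ k => ?_⟩
  calc |a σ k| ≤ ∑ k, |a σ k| :=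
        Finset.single_le_sum (f := fun k => |a σ k|) (fun _ _ => abs_nonneg _) (Finset.mem_univ k)
    _ ≤ _ := Finset.single_le_sum (f := fun σ => ∑ k, |a σ k|) (fun _ _ => by positivity)
        (Finset.mem_univ σ)

theorem exists_abs_le_vector (f : A → ℝ) : ∃ B, 0 ≤ B ∧ ∀ σ, |f σ| ≤ B :=
  ⟨∑ σ, |f σ|, by positivity, fun σ =>
    Finset.single_le_sum (f := fun σ => |f σ|) (fun _ _ => abs_nonneg _) (Finset.mem_univ σ)⟩

variable [Nonempty A]

theorem continuous_log_gibbsZ_ham (c : I → ℝ) (a : A → I → ℝ) (h : A → ℝ) :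
    Continuous fun J => Real.log (gibbsZ (ham c a h J)) :=
  continuous_log_gibbsZ.comp (continuous_ham c a h)

theorem continuous_gibbsAvg_ham (c : I → ℝ) (a : A → I → ℝ) (h f : A → ℝ) :
    Continuous fun J => gibbsAvg (ham c a h J) f :=
  (continuous_gibbsAvg f).comp (continuous_ham c a h)

theorem integrable_log_gibbsZ_ham (c : I → ℝ) (a : A → I → ℝ) (h : A → ℝ) :
    Integrable (fun J => Real.log (gibbsZ (ham c a h J))) (stdGauss I) := by
  obtain ⟨B, -, hB⟩ := exists_abs_le_matrix a
  refine (integrable_sum_abs (fun k => |c k|) B |Real.log (gibbsZ h)|).mono'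
    (continuous_log_gibbsZ_ham c a h).aestronglyMeasurable (Eventually.of_forall fun J => ?_)
  have h1 := abs_log_gibbsZ_sub_le (abs_ham_sub_le hB c 0 (h := h) (h' := h) (D := 0)
    (by simp) J)
  have h2 : ham 0 a h J = h := by ext σ; simp [ham]
  rw [h2] at h1
  simp only [Pi.zero_apply, sub_zero, add_zero] at h1
  rw [Real.norm_eq_abs]
  calc |Real.log (gibbsZ (ham c a h J))|
      = |(Real.log (gibbsZ (ham c a h J)) - Real.log (gibbsZ h)) + Real.log (gibbsZ h)| := by
        rw [sub_add_cancel]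
    _ ≤ _ := (abs_add_le _ _).trans (add_le_add h1 le_rfl)

theorem integrable_gibbsAvg_ham (c : I → ℝ) (a : A → I → ℝ) (h f : A → ℝ) :
    Integrable (fun J => gibbsAvg (ham c a h J) f) (stdGauss I) := by
  obtain ⟨B, -, hB⟩ := exists_abs_le_vector f
  exact Integrable.of_bound (continuous_gibbsAvg_ham c a h f).aestronglyMeasurable B
    (Eventually.of_forall fun J => abs_gibbsAvg_le _ hB)

/-- Serves the endpoints of a trajectory, where the square roots in the amplitudes can fail to be
differentiable. -/
theorem continuous_freeEnergy (a : A → I → ℝ) {c : ℝ → I → ℝ} {h : ℝ → A → ℝ}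
    (hc : Continuous c) (hh : Continuous h) :
    Continuous fun s => freeEnergy (c s) a (h s) := by
  obtain ⟨B, hB0, hB⟩ := exists_abs_le_matrix a
  rw [continuous_iff_continuousAt]
  intro s
  rw [ContinuousAt, tendsto_iff_norm_sub_tendsto_zero]
  have hbound : ∀ u, ‖freeEnergy (c u) a (h u) - freeEnergy (c s) a (h s)‖
      ≤ ∫ J, (∑ k, |c u k - c s k| * |J k| * B + ∑ σ, |h u σ - h s σ|) ∂(stdGauss I) := by
    intro u
    unfold freeEnergy
    rw [← integral_sub (integrable_log_gibbsZ_ham _ _ _) (integrable_log_gibbsZ_ham _ _ _)]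
    refine norm_integral_le_of_norm_le (integrable_sum_abs _ _ _) (Eventually.of_forall fun J => ?_)
    refine abs_log_gibbsZ_sub_le (abs_ham_sub_le hB _ _ (fun σ => ?_) J)
    exact Finset.single_le_sum (f := fun σ => |h u σ - h s σ|) (fun _ _ => abs_nonneg _)
      (Finset.mem_univ σ)
  refine squeeze_zero (fun _ => norm_nonneg _) hbound ?_
  have heq : ∀ u, ∫ J, (∑ k, |c u k - c s k| * |J k| * B + ∑ σ, |h u σ - h s σ|) ∂(stdGauss I)
      = ∑ k, |c u k - c s k| * (∫ J, |J k| ∂(stdGauss I)) * B + ∑ σ, |h u σ - h s σ| := by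
    intro u
    have hi : ∀ k, Integrable (fun J : I → ℝ => |c u k - c s k| * |J k| * B) (stdGauss I) :=
      fun k => (((integrable_eval_stdGauss k).abs).const_mul _).mul_const _
    rw [integral_add (integrable_finsetSum _ fun k _ => hi k) (integrable_const _),
      integral_finsetSum _ fun k _ => hi k]
    simp [integral_mul_const, integral_const_mul]
  simp only [heq]
  have hcont : Continuous fun u => ∑ k, |c u k - c s k| * (∫ J, |J k| ∂(stdGauss I)) * B
      + ∑ σ, |h u σ - h s σ| := by fun_prop
  simpa using hcont.tendsto s

theorem hasDerivAt_freeEnergy_aux (a : A → I → ℝ) {c : ℝ → I → ℝ} {c' : I → ℝ} {h : ℝ → A → ℝ}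
    {h' : A → ℝ} {s : ℝ} (hc : ∀ k, HasDerivAt (fun u => c u k) (c' k) s)
    (hh : ∀ σ, HasDerivAt (fun u => h u σ) (h' σ) s) :
    HasDerivAt (fun u => freeEnergy (c u) a (h u))
      (∫ J, gibbsAvg (ham (c s) a (h s) J) (ham c' a h' J) ∂(stdGauss I)) s := by
  obtain ⟨B, hB0, hB⟩ := exists_abs_le_matrix a
  have hc1 : ∀ k, ∃ C, ∀ᶠ u in 𝓝 s, |c u k - c s k| ≤ C * |u - s| := fun k => by
    obtain ⟨C, hC⟩ := (hc k).isBigO_sub.bound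
    exact ⟨C, hC⟩
  have hh1 : ∀ σ, ∃ D, ∀ᶠ u in 𝓝 s, |h u σ - h s σ| ≤ D * |u - s| := fun σ => by
    obtain ⟨D, hD⟩ := (hh σ).isBigO_sub.bound
    exact ⟨D, hD⟩
  choose C hC using hc1
  choose D hD using hh1
  have hev := (eventually_all.2 hC).and (eventually_all.2 hD)
  have hdiff : ∀ J, HasDerivAt (fun u => Real.log (gibbsZ (ham (c u) a (h u) J)))
      (gibbsAvg (ham (c s) a (h s) J) (ham c' a h' J)) s := by
    intro J
    refine hasDerivAt_log_gibbsZ fun σ => ?_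
    unfold ham
    exact (HasDerivAt.fun_sum fun k _ => ((hc k).mul_const _).mul_const _).add (hh σ)
  have hcont : Continuous fun J => gibbsAvg (ham (c s) a (h s) J) (ham c' a h' J) := by
    unfold gibbsAvg
    refine Continuous.div ?_ (continuous_gibbsZ.comp (continuous_ham _ _ _))
      fun J => (gibbsZ_pos _).ne'
    unfold ham
    fun_prop
  -- `L` sends a number to multiplication by it, since the differentiation theorem used here is
  -- stated for Fréchet derivatives. It only compares with the base point `s`, so differentiability
  -- at `s` alone suffices.
  set L : ℝ →L[ℝ] ℝ →L[ℝ] ℝ := ContinuousLinearMap.smulRightL ℝ ℝ ℝ 1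
  have key := hasFDerivAt_integral_of_dominated_loc_of_lip' (μ := stdGauss I) (𝕜 := ℝ)
    (F := fun u J => Real.log (gibbsZ (ham (c u) a (h u) J)))
    (F' := fun J => L (gibbsAvg (ham (c s) a (h s) J) (ham c' a h' J)))
    (bound := fun J => ∑ k, C k * |J k| * B + ∑ σ, |D σ|) (x₀ := s) hev
    (fun u _ => (continuous_log_gibbsZ_ham _ _ _).aestronglyMeasurable)
    (integrable_log_gibbsZ_ham _ _ _)
    (L.continuous.comp hcont).aestronglyMeasurable
    (Eventually.of_forall fun J u hu => by
      have := abs_log_gibbsZ_sub_le (abs_ham_sub_le hB (c u) (c s) (h := h u) (h' := h s)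
        (D := (∑ σ, |D σ|) * |u - s|) (fun σ => (hu.2 σ).trans ?_) J)
      · refine this.trans ?_
        rw [Real.norm_eq_abs, add_mul, Finset.sum_mul _ (fun k => C k * |J k| * B)]
        refine add_le_add (Finset.sum_le_sum fun k _ => ?_) le_rfl
        calc |c u k - c s k| * |J k| * B ≤ (C k * |u - s|) * |J k| * B := by
              gcongr; exact hu.1 k
          _ = _ := by ring
      · gcongr
        exact (le_abs_self _).trans (Finset.single_le_sum (f := fun σ => |D σ|)
          (fun _ _ => abs_nonneg _) (Finset.mem_univ σ)))
    (integrable_sum_abs _ _ _)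
    (Eventually.of_forall fun J => (hdiff J).hasFDerivAt)
  have hint : Integrable (fun J => gibbsAvg (ham (c s) a (h s) J) (ham c' a h' J))
      (stdGauss I) := by
    have := (ContinuousLinearMap.apply ℝ ℝ (1 : ℝ)).integrable_comp key.1
    simpa [L] using this
  have h3 := key.2.hasDerivAt
  rw [ContinuousLinearMap.integral_comp_comm L hint] at h3
  simp only [L, ContinuousLinearMap.smulRightL_apply_apply, ContinuousLinearMap.smulRight_apply,
    one_apply_eq_self, one_smul] at h3
  exact h3

/-- The derivative of the free energy along a path of Gaussian Hamiltonians. -/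
theorem hasDerivAt_freeEnergy (a : A → I → ℝ) {c : ℝ → I → ℝ} {c' : I → ℝ} {h : ℝ → A → ℝ}
    {h' : A → ℝ} {s : ℝ} (hc : ∀ k, HasDerivAt (fun u => c u k) (c' k) s)
    (hh : ∀ σ, HasDerivAt (fun u => h u σ) (h' σ) s) :
    HasDerivAt (fun u => freeEnergy (c u) a (h u))
      (∫ J, (∑ k, c s k * c' k * (gibbsAvg (ham (c s) a (h s) J) (fun σ => a σ k ^ 2)
          - gibbsAvg (ham (c s) a (h s) J) (fun σ => a σ k) ^ 2)
        + gibbsAvg (ham (c s) a (h s) J) h') ∂(stdGauss I)) s := by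
  classical
  refine (hasDerivAt_freeEnergy_aux a hc hh).congr_deriv ?_
  obtain ⟨B, hB0, hB⟩ := exists_abs_le_matrix a
  have e1 : ∀ J, gibbsAvg (ham (c s) a (h s) J) (ham c' a h' J)
      = ∑ k, c' k * (J k * gibbsAvg (ham (c s) a (h s) J) (fun σ => a σ k))
        + gibbsAvg (ham (c s) a (h s) J) h' := by
    intro J
    unfold ham
    rw [gibbsAvg_add, gibbsAvg_sum]
    simp only [gibbsAvg_const_mul, mul_assoc]
  have hb1 : ∀ k J, |gibbsAvg (ham (c s) a (h s) J) (fun σ => a σ k)| ≤ B :=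
    fun k J => abs_gibbsAvg_le _ fun σ => hB σ k
  have hb2 : ∀ k J, |gibbsAvg (ham (c s) a (h s) J) (fun σ => a σ k ^ 2)| ≤ B ^ 2 :=
    fun k J => abs_gibbsAvg_le _ fun σ => by
      rw [abs_pow]; exact pow_le_pow_left₀ (abs_nonneg _) (hB σ k) 2
  have hvc : ∀ k, Continuous fun J => gibbsAvg (ham (c s) a (h s) J) (fun σ => a σ k ^ 2)
          - gibbsAvg (ham (c s) a (h s) J) (fun σ => a σ k) ^ 2 := fun k =>
    (continuous_gibbsAvg_ham _ _ _ _).sub ((continuous_gibbsAvg_ham _ _ _ _).pow 2)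
  have hvb : ∀ k J, |gibbsAvg (ham (c s) a (h s) J) (fun σ => a σ k ^ 2)
          - gibbsAvg (ham (c s) a (h s) J) (fun σ => a σ k) ^ 2| ≤ B ^ 2 + B ^ 2 := fun k J => by
    refine (abs_sub _ _).trans (add_le_add (hb2 k J) ?_)
    rw [abs_pow]; exact pow_le_pow_left₀ (abs_nonneg _) (hb1 k J) 2
  have hvi : ∀ k, Integrable (fun J => gibbsAvg (ham (c s) a (h s) J) (fun σ => a σ k ^ 2)
          - gibbsAvg (ham (c s) a (h s) J) (fun σ => a σ k) ^ 2) (stdGauss I) := fun k =>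
    Integrable.of_bound (hvc k).aestronglyMeasurable _ (Eventually.of_forall (hvb k))
  have hji : ∀ k, Integrable (fun J => J k * gibbsAvg (ham (c s) a (h s) J) (fun σ => a σ k))
      (stdGauss I) := fun k =>
    (integrable_eval_stdGauss k).mul_bdd
      (continuous_gibbsAvg_ham _ _ _ _).aestronglyMeasurable (Eventually.of_forall (hb1 k))
  -- `J k` enters the Hamiltonian through `c s k * J k * a σ k`, so differentiating the Gibbs mean
  -- of `a · k` in `J k` gives `c s k` times its variance.
  have stein : ∀ k, ∫ J, J k * gibbsAvg (ham (c s) a (h s) J) (fun σ => a σ k) ∂(stdGauss I)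
      = ∫ J, c s k * (gibbsAvg (ham (c s) a (h s) J) (fun σ => a σ k ^ 2)
          - gibbsAvg (ham (c s) a (h s) J) (fun σ => a σ k) ^ 2) ∂(stdGauss I) := by
    intro k
    refine integral_eval_mul_stdGauss k (C := B) (C' := |c s k| * (B ^ 2 + B ^ 2))
      (continuous_gibbsAvg_ham _ _ _ _) ((hvc k).const_mul _) (hb1 k) (fun J => ?_) ?_
    · rw [abs_mul]
      exact mul_le_mul_of_nonneg_left (hvb k J) (abs_nonneg _)
    · intro J z
      have hd : ∀ σ, HasDerivAt (fun y => ham (c s) a (h s) (Function.update J k y) σ)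
          (c s k * a σ k) z := by
        intro σ
        unfold ham
        have : HasDerivAt (fun y => ∑ i, c s i * Function.update J k y i * a σ i)
            (∑ i, if i = k then c s i * a σ i else 0) z := by
          refine HasDerivAt.fun_sum fun i _ => ?_
          by_cases hi : i = k
          · subst hi
            simpa using ((hasDerivAt_id z).const_mul (c s i)).mul_const (a σ i)
          · simpa [Function.update_of_ne hi, hi] using hasDerivAt_const z _
        simpa using this.add_const (h s σ)
      refine (hasDerivAt_gibbsAvg (fun σ => a σ k) hd).congr_deriv ?_
      have : (fun σ => a σ k * (c s k * a σ k)) = fun σ => c s k * a σ k ^ 2 := by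
        ext σ; ring
      rw [this, gibbsAvg_const_mul, gibbsAvg_const_mul]
      ring
  simp only [e1]
  rw [integral_add (integrable_finsetSum _ fun k _ => (hji k).const_mul _)
      (integrable_gibbsAvg_ham _ _ _ _),
    integral_add (integrable_finsetSum _ fun k _ => (hvi k).const_mul _)
      (integrable_gibbsAvg_ham _ _ _ _),
    integral_finsetSum _ fun k _ => (hji k).const_mul _,
    integral_finsetSum _ fun k _ => (hvi k).const_mul _]
  congr 1
  refine Finset.sum_congr rfl fun k _ => ?_
  rw [integral_const_mul, stein, integral_const_mul, integral_const_mul]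
  ring

/-- Thermal variances as averages over two independent replicas. -/
theorem sum_variance_eq_replicas (H : A → ℝ) (κ : I → ℝ) (a : A → I → ℝ) :
    ∑ k, κ k * (gibbsAvg H (fun σ => a σ k ^ 2) - gibbsAvg H (fun σ => a σ k) ^ 2)
      = gibbsAvg (fun p : A × A => H p.1 + H p.2)
        (fun p => ∑ k, κ k * (a p.1 k * a p.1 k) - ∑ k, κ k * (a p.1 k * a p.2 k)) := by
  simp only [← Finset.sum_sub_distrib, ← mul_sub]
  rw [gibbsAvg_sum]
  refine Finset.sum_congr rfl fun k _ => ?_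
  rw [gibbsAvg_const_mul]
  congr 1
  have h1 := gibbsAvg_prod H H (fun σ => a σ k ^ 2) (fun _ => 1)
  have h2 := gibbsAvg_prod H H (fun σ => a σ k) (fun σ => -a σ k)
  have h3 := gibbsAvg_const_mul H (fun σ => a σ k) (-1)
  simp only [neg_one_mul] at h3
  rw [gibbsAvg_const, mul_one] at h1
  rw [h3] at h2
  rw [pow_two (gibbsAvg H fun σ => a σ k), sub_eq_add_neg, ← neg_one_mul, mul_left_comm,
    neg_one_mul, ← h1, ← h2, ← gibbsAvg_add]
  congr 1
  ext p
  ring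

/-- Two replicas sharing the disorder again form a Gaussian Hamiltonian, with summed coefficients.
-/
theorem integrable_gibbsAvg_replicas (c : I → ℝ) (a : A → I → ℝ) (h : A → ℝ) (f : A × A → ℝ) :
    Integrable (fun J => gibbsAvg (fun p : A × A => ham c a h J p.1 + ham c a h J p.2) f)
      (stdGauss I) := by
  have : ∀ J, (fun p : A × A => ham c a h J p.1 + ham c a h J p.2)
      = ham c (fun p : A × A => fun k => a p.1 k + a p.2 k) (fun p => h p.1 + h p.2) J := by
    intro J
    ext p
    simp only [ham, mul_add, Finset.sum_add_distrib]
    ring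
  simp only [this]
  exact integrable_gibbsAvg_ham _ _ _ _

/-- The derivative of the free energy in terms of two independent replicas. -/
theorem hasDerivAt_freeEnergy_replicas (a : A → I → ℝ) {c : ℝ → I → ℝ} {c' κ : I → ℝ}
    {h : ℝ → A → ℝ} {h' : A → ℝ} {s : ℝ} (hc : ∀ k, HasDerivAt (fun u => c u k) (c' k) s)
    (hκ : ∀ k, c s k * c' k = κ k) (hh : ∀ σ, HasDerivAt (fun u => h u σ) (h' σ) s) :
    HasDerivAt (fun u => freeEnergy (c u) a (h u))
      (∫ J, gibbsAvg (fun p : A × A => ham (c s) a (h s) J p.1 + ham (c s) a (h s) J p.2)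
        (fun p => ∑ k, κ k * (a p.1 k * a p.1 k) - ∑ k, κ k * (a p.1 k * a p.2 k) + h' p.1)
        ∂(stdGauss I)) s := by
  refine (hasDerivAt_freeEnergy a hc hh).congr_deriv ?_
  congr 1
  ext J
  simp only [hκ]
  rw [sum_variance_eq_replicas, gibbsAvg_add]
  congr 1
  have := gibbsAvg_prod (ham (c s) a (h s) J) (ham (c s) a (h s) J) h' (fun _ => 1)
  rw [gibbsAvg_const, mul_one] at this
  rw [← this]
  simp only [mul_one]

end FreeEnergy

/-! ### The Sherrington-Kirkpatrick model as a Gaussian Hamiltonian -/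

theorem spin_mul_self (s : Bool) : spin s * spin s = 1 := by
  cases s <;> simp [spin]

theorem abs_spin (s : Bool) : |spin s| = 1 := by
  cases s <;> simp [spin]

/-- The amplitudes of the couplings and of the one-body fields. -/
def amplitude (N : ℕ) (x t : ℝ) : Couple N ⊕ Fin N → ℝ :=
  Sum.elim (fun _ => √(t / N)) (fun _ => √x)

/-- The monomials in the spins multiplying the disorder variables. -/
def monomial (N : ℕ) (σ : Config N) : Couple N ⊕ Fin N → ℝ :=
  Sum.elim (fun p => spin (σ p.1.1) * spin (σ p.1.2)) (fun i => spin (σ i))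

theorem energy_eq_ham (N : ℕ) (b x t : ℝ) (J : Disorder N) :
    energy N b x t J = ham (amplitude N x t) (monomial N) (fun σ => b * ∑ i, spin (σ i)) J := by
  ext σ
  simp only [energy, ham, amplitude, monomial, Fintype.sum_sum_type, Sum.elim_inl, Sum.elim_inr,
    Finset.mul_sum, mul_assoc]
  ring

theorem alpha_eq_freeEnergy (N : ℕ) (b x t : ℝ) :
    alpha N b x t = (N : ℝ)⁻¹ *
      freeEnergy (amplitude N x t) (monomial N) (fun σ => b * ∑ i, spin (σ i)) := by
  unfold alpha freeEnergy
  simp only [← energy_eq_ham]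
  rfl

theorem sum_couple_mul {N : ℕ} (f : Fin N → ℝ) :
    ∑ p : Couple N, f p.1.1 * f p.1.2 = ((∑ i, f i) ^ 2 - ∑ i, f i ^ 2) / 2 := by
  have h1 : ∑ p : Couple N, f p.1.1 * f p.1.2
      = ∑ i, ∑ j, if i < j then f i * f j else 0 := by
    rw [← Fintype.sum_prod_type' (f := fun i j => if i < j then f i * f j else 0),
      ← Finset.sum_filter]
    exact (Finset.sum_subtype (Finset.univ.filter fun p : Fin N × Fin N => p.1 < p.2)
      (by simp) (fun p : Fin N × Fin N => f p.1 * f p.2)).symm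
  have h2 : ∑ i, ∑ j, (if i < j then f i * f j else 0)
      = ∑ i, ∑ j, if j < i then f i * f j else 0 := by
    rw [Finset.sum_comm]
    simp only [mul_comm]
  have h3 : (∑ i, f i) ^ 2 = ∑ i, ∑ j, (if i < j then f i * f j else 0)
      + ∑ i, ∑ j, (if j < i then f i * f j else 0) + ∑ i, f i ^ 2 := by
    have h4 : ∑ i, f i ^ 2 = ∑ i, ∑ j, if i = j then f i * f j else 0 := by
      simp [pow_two]
    rw [h4, pow_two, Finset.sum_mul_sum]
    simp only [← Finset.sum_add_distrib]
    refine Finset.sum_congr rfl fun i _ => Finset.sum_congr rfl fun j _ => ?_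
    rcases lt_trichotomy i j with h | h | h
    · simp [h, h.not_gt, h.ne]
    · simp [h]
    · simp [h, h.not_gt, h.ne']
  rw [h1, h3, ← h2]
  ring

/-- Half of the rate of change of the squared amplitudes along `s ↦ (x₀ - m s, s)`. -/
def rate (N : ℕ) (m : ℝ) : Couple N ⊕ Fin N → ℝ :=
  Sum.elim (fun _ => 1 / (2 * N)) (fun _ => -(m / 2))

/-- The couplings contribute `N q² / 4 - 1 / 4`, where `-1 / 4` corrects for the absent diagonal,
and the fields contribute `-m N q / 2`; completing the square gives the result. The additive
constants cancel between self and cross overlaps. -/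
theorem sum_rate_monomial {N : ℕ} (hN : N ≠ 0) (m : ℝ) (σ τ : Config N) :
    ∑ k, rate N m k * (monomial N σ k * monomial N τ k)
      = N / 4 * ((overlap N σ τ - m) ^ 2 - m ^ 2) - 1 / 4 := by
  have hN' : (N : ℝ) ≠ 0 := by exact_mod_cast hN
  simp only [rate, monomial, Fintype.sum_sum_type, Sum.elim_inl, Sum.elim_inr, ← Finset.mul_sum]
  have h1 : ∑ p : Couple N, spin (σ p.1.1) * spin (σ p.1.2) * (spin (τ p.1.1) * spin (τ p.1.2))
      = ((∑ i, spin (σ i) * spin (τ i)) ^ 2 - N) / 2 := by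
    have := sum_couple_mul (fun i => spin (σ i) * spin (τ i))
    have h2 : ∀ i, (spin (σ i) * spin (τ i)) ^ 2 = 1 := fun i => by
      rw [mul_pow, pow_two, pow_two, spin_mul_self, spin_mul_self, one_mul]
    simp only [h2, Finset.sum_const, Finset.card_univ, Fintype.card_fin, nsmul_eq_mul,
      mul_one] at this
    rw [← this]
    exact Finset.sum_congr rfl fun p _ => by ring
  rw [h1, overlap]
  field_simp
  ring

theorem overlap_self {N : ℕ} (hN : N ≠ 0) (σ : Config N) : overlap N σ σ = 1 := by
  have hN' : (N : ℝ) ≠ 0 := by exact_mod_cast hN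
  simp [overlap, spin_mul_self, hN']

theorem overlap_comm (N : ℕ) (σ τ : Config N) : overlap N σ τ = overlap N τ σ := by
  simp only [overlap, mul_comm (spin (σ _))]

theorem abs_overlap_le_one (N : ℕ) (σ τ : Config N) : |overlap N σ τ| ≤ 1 := by
  rw [overlap, abs_mul, abs_of_nonneg (by positivity : (0 : ℝ) ≤ (N : ℝ)⁻¹)]
  have h : |∑ i, spin (σ i) * spin (τ i)| ≤ N := by
    refine (Finset.abs_sum_le_sum_abs _ _).trans ?_
    simp [abs_mul, abs_spin]
  calc (N : ℝ)⁻¹ * |∑ i, spin (σ i) * spin (τ i)| ≤ (N : ℝ)⁻¹ * N := by gcongr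
    _ ≤ 1 := inv_mul_le_one

theorem sq_overlap_sub_le (N : ℕ) (σ τ : Config N) {m : ℝ} (hm0 : 0 ≤ m) (hm1 : m ≤ 1) :
    (overlap N σ τ - m) ^ 2 ≤ 4 := by
  have h := abs_le.1 (abs_overlap_le_one N σ τ)
  nlinarith [h.1, h.2]

/-! ### Derivatives along the trajectories -/

/-- The product of an amplitude and its derivative is half the derivative of its square, and the
squares are affine in time. If `m = 0` the field amplitude is constant, so `x₀ = 0` does no harm. -/
theorem exists_hasDerivAt_amplitude {N : ℕ} (hN : N ≠ 0) {x₀ m s : ℝ} (hs : 0 < s)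
    (hp : 0 < x₀ - m * s ∨ m = 0) :
    ∃ c' : Couple N ⊕ Fin N → ℝ,
      (∀ k, HasDerivAt (fun u => amplitude N (x₀ - m * u) u k) (c' k) s) ∧
      ∀ k, amplitude N (x₀ - m * s) s k * c' k = rate N m k := by
  have hN' : (0 : ℝ) < N := by exact_mod_cast Nat.pos_of_ne_zero hN
  have h1 : HasDerivAt (fun u : ℝ => √(u / N)) (1 / N / (2 * √(s / N))) s :=
    ((hasDerivAt_id s).div_const (N : ℝ)).sqrt (by positivity)
  have h1' : √(s / N) * (1 / N / (2 * √(s / N))) = 1 / (2 * N) := by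
    have : √(s / N) ≠ 0 := by positivity
    field_simp
  have h2 : ∃ d, HasDerivAt (fun u : ℝ => √(x₀ - m * u)) d s ∧ √(x₀ - m * s) * d = -(m / 2) := by
    rcases hp with hp | hp
    · have hd : HasDerivAt (fun u : ℝ => x₀ - m * u) (-m) s := by
        simpa using ((hasDerivAt_id s).const_mul m).const_sub x₀
      refine ⟨_, hd.sqrt hp.ne', ?_⟩
      have : √(x₀ - m * s) ≠ 0 := (Real.sqrt_pos.2 hp).ne'
      field_simp
    · subst hp
      exact ⟨0, by simpa using hasDerivAt_const s (√x₀), by simp⟩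
  obtain ⟨d, hd, hd'⟩ := h2
  refine ⟨Sum.elim (fun _ => 1 / N / (2 * √(s / N))) (fun _ => d), ?_, ?_⟩
  · rintro (p | i)
    · exact h1
    · exact hd
  · rintro (p | i)
    · exact h1'
    · exact hd'

theorem continuous_amplitude (N : ℕ) (x₀ m : ℝ) :
    Continuous fun u => amplitude N (x₀ - m * u) u := by
  refine continuous_pi ?_
  rintro (p | i) <;> simp only [amplitude, Sum.elim_inl, Sum.elim_inr] <;> fun_prop

/-- The quenched average of `(q₁₂ - m)²` for two uncoupled replicas. -/
def meanSqDev (N : ℕ) (b x t m : ℝ) : ℝ :=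
  ∫ J, gibbsAvg (fun p : Config N × Config N => energy N b x t J p.1 + energy N b x t J p.2)
    (fun p => (overlap N p.1 p.2 - m) ^ 2) ∂(disorderLaw N)

theorem meanSqDev_nonneg (N : ℕ) (b x t m : ℝ) : 0 ≤ meanSqDev N b x t m :=
  integral_nonneg fun _ => gibbsAvg_nonneg _ fun _ => sq_nonneg _

instance isProbabilityMeasure_disorderLaw (N : ℕ) : IsProbabilityMeasure (disorderLaw N) := by
  unfold disorderLaw; infer_instance

theorem meanSqDev_le (N : ℕ) (b x t : ℝ) {m : ℝ} (hm0 : 0 ≤ m) (hm1 : m ≤ 1) :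
    meanSqDev N b x t m ≤ 4 := by
  have h := norm_integral_le_of_norm_le_const (μ := disorderLaw N) (C := 4)
    (f := fun J => gibbsAvg
      (fun p : Config N × Config N => energy N b x t J p.1 + energy N b x t J p.2)
      (fun p => (overlap N p.1 p.2 - m) ^ 2))
    (Eventually.of_forall fun J => abs_gibbsAvg_le _ fun p => by
      rw [abs_of_nonneg (sq_nonneg _)]; exact sq_overlap_sub_le N _ _ hm0 hm1)
  simpa [meanSqDev] using (le_abs_self _).trans h

theorem integrable_sqDev (N : ℕ) (b x t m : ℝ) :
    Integrable (fun J => gibbsAvg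
      (fun p : Config N × Config N => energy N b x t J p.1 + energy N b x t J p.2)
      (fun p => (overlap N p.1 p.2 - m) ^ 2)) (disorderLaw N) := by
  simp only [energy_eq_ham]
  exact integrable_gibbsAvg_replicas _ _ _ _

theorem continuous_alpha_path (N : ℕ) (b x₀ m : ℝ) :
    Continuous fun u => alpha N b (x₀ - m * u) u := by
  simp only [alpha_eq_freeEnergy]
  exact (continuous_freeEnergy _ (continuous_amplitude N x₀ m) continuous_const).const_mul _

theorem hasDerivAt_alpha_path {N : ℕ} (hN : N ≠ 0) (b : ℝ) {x₀ m s : ℝ} (hs : 0 < s)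
    (hp : 0 < x₀ - m * s ∨ m = 0) :
    HasDerivAt (fun u => alpha N b (x₀ - m * u) u)
      (1 / 4 * (1 - m) ^ 2 - 1 / 4 * meanSqDev N b (x₀ - m * s) s m) s := by
  have hN' : (N : ℝ) ≠ 0 := by exact_mod_cast hN
  obtain ⟨c', hc, hκ⟩ := exists_hasDerivAt_amplitude hN hs hp
  simp only [alpha_eq_freeEnergy]
  refine ((hasDerivAt_freeEnergy_replicas (monomial N) hc hκ (h' := fun _ => 0)
    (h := fun _ σ => b * ∑ i, spin (σ i)) fun σ => hasDerivAt_const s _).const_mul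
    (N : ℝ)⁻¹).congr_deriv ?_
  have h1 : ∀ p : Config N × Config N,
      ∑ k, rate N m k * (monomial N p.1 k * monomial N p.1 k)
        - ∑ k, rate N m k * (monomial N p.1 k * monomial N p.2 k) + 0
      = N / 4 * (1 - m) ^ 2 + -(N / 4) * (overlap N p.1 p.2 - m) ^ 2 := by
    intro p
    rw [sum_rate_monomial hN, sum_rate_monomial hN, overlap_self hN]
    ring
  simp only [h1, gibbsAvg_add, gibbsAvg_const_mul, ← energy_eq_ham]
  have h2 := integrable_sqDev N b (x₀ - m * s) s m
  have h3 : meanSqDev N b (x₀ - m * s) s m = ∫ J, gibbsAvg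
      (fun p : Config N × Config N => energy N b (x₀ - m * s) s J p.1
        + energy N b (x₀ - m * s) s J p.2)
      (fun p => (overlap N p.1 p.2 - m) ^ 2) ∂(stdGauss (Couple N ⊕ Fin N)) := rfl
  rw [integral_add, integral_const_mul, integral_const_mul, ← h3]
  · simp only [gibbsAvg_const, integral_const, probReal_univ, one_smul]
    field_simp
    ring
  · simp only [gibbsAvg_const]
    exact integrable_const _
  · exact h2.const_mul _

/-! ### The coupled replicas -/

/-- The deterministic part of the Hamiltonian of the coupled replicas. -/
def pairField (N : ℕ) (b lam m : ℝ) (p : Config N × Config N) : ℝ :=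
  b * ∑ i, spin (p.1 i) + b * ∑ i, spin (p.2 i) + lam / 2 * N * (overlap N p.1 p.2 - m) ^ 2

/-- The monomials of the Hamiltonian of the coupled replicas. -/
def pairMonomial (N : ℕ) (p : Config N × Config N) (k : Couple N ⊕ Fin N) : ℝ :=
  monomial N p.1 k + monomial N p.2 k

/-- The free energy of two replicas coupled by `(lam / 2) N (q₁₂ - m)²`. -/
def coupledFreeEnergy (N : ℕ) (b x lam t m : ℝ) : ℝ :=
  freeEnergy (amplitude N x t) (pairMonomial N) (pairField N b lam m)

theorem ham_pair (N : ℕ) (b x lam t m : ℝ) (J : Disorder N) :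
    ham (amplitude N x t) (pairMonomial N) (pairField N b lam m) J
      = fun p => energy N b x t J p.1 + energy N b x t J p.2
        + lam / 2 * N * (overlap N p.1 p.2 - m) ^ 2 := by
  ext p
  simp only [energy_eq_ham, ham, pairMonomial, pairField, mul_add, Finset.sum_add_distrib]
  ring

theorem coupledAlpha_eq (N : ℕ) (b x lam t : ℝ) :
    coupledAlpha N b x lam t
      = (2 * (N : ℝ))⁻¹ * coupledFreeEnergy N b x lam t (qbarAt b x t) := by
  unfold coupledAlpha coupledFreeEnergy freeEnergy
  simp only [ham_pair, gibbsZ, coupledPartition, Fintype.sum_prod_type]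
  rfl

theorem coupledFreeEnergy_zero {N : ℕ} (hN : N ≠ 0) (b x t m : ℝ) :
    coupledFreeEnergy N b x 0 t m = 2 * N * alpha N b x t := by
  have hN' : (N : ℝ) ≠ 0 := by exact_mod_cast hN
  unfold coupledFreeEnergy freeEnergy
  rw [alpha_eq_freeEnergy, freeEnergy]
  simp only [ham_pair, ← energy_eq_ham, zero_div, zero_mul, add_zero]
  have : ∀ J, Real.log (gibbsZ fun p : Config N × Config N =>
      energy N b x t J p.1 + energy N b x t J p.2)
      = 2 * Real.log (gibbsZ (energy N b x t J)) := fun J => by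
    rw [gibbsZ_prod, Real.log_mul (gibbsZ_pos _).ne' (gibbsZ_pos _).ne']
    ring
  simp only [this, integral_const_mul]
  field_simp

/-- Jensen's inequality with the coupling term as perturbation of the uncoupled pair; `lam` may have
either sign. -/
theorem meanSqDev_le_coupledFreeEnergy (N : ℕ) (b x lam t m : ℝ) :
    lam / 2 * N * meanSqDev N b x t m
      ≤ coupledFreeEnergy N b x lam t m - coupledFreeEnergy N b x 0 t m := by
  unfold coupledFreeEnergy freeEnergy
  rw [← integral_sub (integrable_log_gibbsZ_ham _ _ _) (integrable_log_gibbsZ_ham _ _ _),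
    meanSqDev, ← integral_const_mul]
  refine integral_mono ((integrable_sqDev N b x t m).const_mul _)
    ((integrable_log_gibbsZ_ham _ _ _).sub (integrable_log_gibbsZ_ham _ _ _)) fun J => ?_
  simp only [ham_pair, zero_div, zero_mul, add_zero]
  rw [← gibbsAvg_const_mul]
  exact gibbsAvg_le_log_gibbsZ_sub _ _

theorem continuous_coupledFreeEnergy_path (N : ℕ) (b x₀ m lam₀ : ℝ) :
    Continuous fun u => coupledFreeEnergy N b (x₀ - m * u) (lam₀ - u) u m := by
  refine continuous_freeEnergy _ (continuous_amplitude N x₀ m) ?_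
  unfold pairField
  fun_prop

/-- Two copies of the coupled pair carry four replicas. The self term of a pair yields `(N / 2) (1 -
m)²` and `(N / 2) (q₁₂ - m)²`; the latter is cancelled exactly by the decreasing coupling. The four
overlaps between the pairs enter with a minus sign and are dropped. -/
theorem exists_hasDerivAt_coupledFreeEnergy_path {N : ℕ} (hN : N ≠ 0) (b lam₀ : ℝ) {x₀ m s : ℝ}
    (hs : 0 < s) (hp : 0 < x₀ - m * s ∨ m = 0) :
    ∃ d ≤ N / 2 * (1 - m) ^ 2,
      HasDerivAt (fun u => coupledFreeEnergy N b (x₀ - m * u) (lam₀ - u) u m) d s := by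
  obtain ⟨c', hc, hκ⟩ := exists_hasDerivAt_amplitude hN hs hp
  have hh : ∀ p : Config N × Config N, HasDerivAt (fun u => pairField N b (lam₀ - u) m p)
      (-(N / 2) * (overlap N p.1 p.2 - m) ^ 2) s := by
    intro p
    unfold pairField
    have := (((((hasDerivAt_id s).const_sub lam₀).div_const 2).mul_const (N : ℝ)).mul_const
      ((overlap N p.1 p.2 - m) ^ 2)).const_add (b * ∑ i, spin (p.1 i) + b * ∑ i, spin (p.2 i))
    refine this.congr_deriv ?_
    ring
  refine ⟨_, ?_, hasDerivAt_freeEnergy_replicas (pairMonomial N) hc hκ hh⟩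
  have hb : ∀ J : Disorder N, gibbsAvg _ _ ≤ N / 2 * (1 - m) ^ 2 := fun J =>
    (gibbsAvg_mono (fun p : (Config N × Config N) × (Config N × Config N) =>
        ham (amplitude N (x₀ - m * s) s) (pairMonomial N) (pairField N b (lam₀ - s) m) J p.1
        + ham (amplitude N (x₀ - m * s) s) (pairMonomial N) (pairField N b (lam₀ - s) m) J p.2)
      (f := fun p => ∑ k, rate N m k * (pairMonomial N p.1 k * pairMonomial N p.1 k)
        - ∑ k, rate N m k * (pairMonomial N p.1 k * pairMonomial N p.2 k)
        + -(N / 2) * (overlap N p.1.1 p.1.2 - m) ^ 2)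
      (g := fun _ => N / 2 * (1 - m) ^ 2) (fun p => by
        have e : ∀ p q : Config N × Config N,
            ∑ k, rate N m k * (pairMonomial N p k * pairMonomial N q k)
            = ∑ k, rate N m k * (monomial N p.1 k * monomial N q.1 k)
              + ∑ k, rate N m k * (monomial N p.1 k * monomial N q.2 k)
              + ∑ k, rate N m k * (monomial N p.2 k * monomial N q.1 k)
              + ∑ k, rate N m k * (monomial N p.2 k * monomial N q.2 k) := by
          intro p q
          simp only [← Finset.sum_add_distrib]
          exact Finset.sum_congr rfl fun k _ => by simp only [pairMonomial]; ring
        simp only [e, sum_rate_monomial hN, overlap_self hN, overlap_comm N p.1.2 p.1.1]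
        have hN' : (0 : ℝ) ≤ N := by positivity
        nlinarith [mul_nonneg hN' (sq_nonneg (overlap N p.1.1 p.2.1 - m)),
          mul_nonneg hN' (sq_nonneg (overlap N p.1.1 p.2.2 - m)),
          mul_nonneg hN' (sq_nonneg (overlap N p.1.2 p.2.1 - m)),
          mul_nonneg hN' (sq_nonneg (overlap N p.1.2 p.2.2 - m))])).trans_eq (gibbsAvg_const _ _)
  refine (integral_mono (integrable_gibbsAvg_replicas _ _ _ _) (integrable_const _) hb).trans_eq ?_
  simp

/-! ### The model without two-body couplings -/

/-- Without couplings the exponent is a sum over sites, so the sum over configurations factorizes.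
-/
theorem partition_zero (N : ℕ) (b x : ℝ) (J : Disorder N) :
    partition N b x 0 J = ∏ i, (2 * Real.cosh (b + J (Sum.inr i) * √x)) := by
  have h1 : ∀ σ : Config N, Real.exp (energy N b x 0 J σ)
      = ∏ i, Real.exp ((b + J (Sum.inr i) * √x) * spin (σ i)) := by
    intro σ
    rw [← Real.exp_sum]
    congr 1
    rw [energy, zero_div, Real.sqrt_zero, zero_mul, zero_add, Finset.mul_sum, Finset.mul_sum,
      ← Finset.sum_add_distrib]
    exact Finset.sum_congr rfl fun i _ => by ring
  have h2 : ∀ y : ℝ, 2 * Real.cosh y = ∑ s : Bool, Real.exp (y * spin s) := by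
    intro y
    rw [Fintype.sum_bool, Real.cosh_eq]
    simp only [spin, if_true, Bool.false_eq_true, if_false, mul_one, mul_neg]
    ring
  simp only [partition, h1, h2]
  rw [Finset.prod_univ_sum, Fintype.piFinset_univ]

theorem integrable_log_cosh (b y : ℝ) :
    Integrable (fun z => Real.log (Real.cosh (b + z * y))) (gaussianReal 0 1) := by
  have hc : Continuous fun z : ℝ => Real.log (Real.cosh (b + z * y)) :=
    (Real.continuous_cosh.comp (by fun_prop)).log fun z => (Real.cosh_pos _).ne'
  refine ((integrable_const |b|).add (integrable_id_gaussianReal.abs.mul_const |y|)).mono'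
    hc.aestronglyMeasurable (Eventually.of_forall fun z => ?_)
  have h1 : (0 : ℝ) ≤ Real.log (Real.cosh (b + z * y)) := Real.log_nonneg (Real.one_le_cosh _)
  have h2 : Real.cosh (b + z * y) ≤ Real.exp |b + z * y| := by
    rw [Real.cosh_eq]
    have e1 := Real.exp_le_exp.2 (le_abs_self (b + z * y))
    have e2 := Real.exp_le_exp.2 (neg_le_abs (b + z * y))
    linarith
  rw [Real.norm_eq_abs, abs_of_nonneg h1]
  calc Real.log (Real.cosh (b + z * y)) ≤ |b + z * y| := by
        rw [← Real.log_exp |b + z * y|]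
        exact Real.log_le_log (Real.cosh_pos _) h2
    _ ≤ |b| + |z * y| := abs_add_le _ _
    _ = _ := by rw [abs_mul]; rfl

theorem alpha_zero {N : ℕ} (hN : N ≠ 0) (b x : ℝ) :
    alpha N b x 0
      = Real.log 2 + ∫ z, Real.log (Real.cosh (b + z * √x)) ∂(gaussianReal 0 1) := by
  have hN' : (N : ℝ) ≠ 0 := by exact_mod_cast hN
  have h1 : ∀ J : Disorder N, Real.log (partition N b x 0 J)
      = ∑ i, (Real.log 2 + Real.log (Real.cosh (b + J (Sum.inr i) * √x))) := by
    intro J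
    rw [partition_zero, Real.log_prod fun i _ => by positivity]
    exact Finset.sum_congr rfl fun i _ => Real.log_mul two_ne_zero (Real.cosh_pos _).ne'
  have hi := (integrable_const (Real.log 2)).add (integrable_log_cosh b (√x))
  have h2 : ∀ i : Fin N, ∫ J : Disorder N,
      (Real.log 2 + Real.log (Real.cosh (b + J (Sum.inr i) * √x))) ∂(disorderLaw N)
      = Real.log 2 + ∫ z, Real.log (Real.cosh (b + z * √x)) ∂(gaussianReal 0 1) := by
    intro i
    have := integral_comp_eval (μ := fun _ : Couple N ⊕ Fin N => gaussianReal 0 1)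
      (i := Sum.inr i) hi.aestronglyMeasurable
    refine this.trans ?_
    simp only [Pi.add_apply]
    rw [integral_add (integrable_const _) (integrable_log_cosh b (√x))]
    simp
  unfold alpha
  simp only [h1]
  rw [integral_finsetSum _ fun i _ => ?_]
  · simp only [h2]
    rw [Finset.sum_const, Finset.card_univ, Fintype.card_fin, nsmul_eq_mul,
      inv_mul_cancel_left₀ hN']
  · exact integrable_comp_eval (μ := fun _ : Couple N ⊕ Fin N => gaussianReal 0 1)
      (i := Sum.inr i) hi

/-! ### The deviation from the replica symmetric value -/

theorem monotoneOn_Icc_of_hasDerivAt_nonneg {f : ℝ → ℝ} {l r : ℝ} (hf : Continuous f)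
    (hd : ∀ u ∈ Set.Ioo l r, ∃ d, 0 ≤ d ∧ HasDerivAt f d u) : MonotoneOn f (Set.Icc l r) := by
  refine monotoneOn_of_deriv_nonneg (convex_Icc l r) hf.continuousOn ?_ ?_ <;>
    rw [interior_Icc] <;> intro u hu <;> obtain ⟨d, hd0, hd⟩ := hd u hu
  · exact hd.differentiableAt.differentiableWithinAt
  · rwa [hd.deriv]

/-- The gap between the replica symmetric value and `α_N` at time `u` on the trajectory
of slope `-m` starting at `x₀`. -/
def gap (N : ℕ) (b x₀ m u : ℝ) : ℝ :=
  alpha N b x₀ 0 + u / 4 * (1 - m) ^ 2 - alpha N b (x₀ - m * u) u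

theorem continuous_gap (N : ℕ) (b x₀ m : ℝ) : Continuous (gap N b x₀ m) := by
  have := continuous_alpha_path N b x₀ m
  unfold gap
  fun_prop

theorem gap_zero (N : ℕ) (b x₀ m : ℝ) : gap N b x₀ m 0 = 0 := by
  simp [gap]

theorem hasDerivAt_gap {N : ℕ} (hN : N ≠ 0) (b : ℝ) {x₀ m s : ℝ} (hs : 0 < s)
    (hp : 0 < x₀ - m * s ∨ m = 0) :
    HasDerivAt (gap N b x₀ m) (1 / 4 * meanSqDev N b (x₀ - m * s) s m) s := by
  have h1 := ((((hasDerivAt_id s).div_const 4).mul_const ((1 - m) ^ 2)).const_add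
    (alpha N b x₀ 0)).sub (hasDerivAt_alpha_path hN b hs hp)
  refine h1.congr_deriv ?_
  ring

/-! ### Differential inequalities along one trajectory. -/

section Trajectory

variable {N : ℕ} {b x₀ m T : ℝ}

/-- The field strength may vanish at the final time `T`, but before it only if `m = 0`. -/
theorem trajectory_pos_or (hm0 : 0 ≤ m) (hT : 0 ≤ x₀ - m * T) {u : ℝ} (hu : u < T) :
    0 < x₀ - m * u ∨ m = 0 := by
  rcases hm0.eq_or_lt with h | h
  · exact Or.inr h.symm
  · left
    nlinarith

theorem gap_nonneg (hN : N ≠ 0) (hm0 : 0 ≤ m) (hT0 : 0 ≤ T) (hT : 0 ≤ x₀ - m * T) :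
    0 ≤ gap N b x₀ m T := by
  have h := monotoneOn_Icc_of_hasDerivAt_nonneg (l := 0) (r := T) (continuous_gap N b x₀ m)
    fun u hu => ⟨_, by have := meanSqDev_nonneg N b (x₀ - m * u) u m; positivity,
      hasDerivAt_gap hN b hu.1 (trajectory_pos_or hm0 hT hu.2)⟩
  simpa [gap_zero] using h (Set.left_mem_Icc.2 hT0) (Set.right_mem_Icc.2 hT0) hT0

/-- Since `(q₁₂ - m)² ≤ 4`, the gap grows at rate at most `1` whatever `N` is; this gives access to
the threshold itself. -/
theorem gap_le_gap_add (hN : N ≠ 0) (hm0 : 0 ≤ m) (hm1 : m ≤ 1) (hT : 0 ≤ x₀ - m * T)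
    {s : ℝ} (hs : 0 ≤ s) (hsT : s ≤ T) :
    gap N b x₀ m T ≤ gap N b x₀ m s + (T - s) := by
  have h := monotoneOn_Icc_of_hasDerivAt_nonneg (f := fun u => u - gap N b x₀ m u) (l := 0)
    (r := T) (continuous_id.sub (continuous_gap N b x₀ m))
    fun u hu => ⟨1 - 1 / 4 * meanSqDev N b (x₀ - m * u) u m,
      by linarith [meanSqDev_le N b (x₀ - m * u) u hm0 hm1],
      (hasDerivAt_id u).sub (hasDerivAt_gap hN b hu.1 (trajectory_pos_or hm0 hT hu.2))⟩
  have := h ⟨hs, hsT⟩ (Set.right_mem_Icc.2 (hs.trans hsT)) hsT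
  simp only at this
  linarith

/-- The coupled free energy along `s ↦ (x₀ - m s, lam₀ - s, s)` grows at most linearly. -/
theorem coupledFreeEnergy_path_le (hN : N ≠ 0) (hm0 : 0 ≤ m) (hT0 : 0 ≤ T)
    (hT : 0 ≤ x₀ - m * T) (lam₀ : ℝ) :
    coupledFreeEnergy N b (x₀ - m * T) (lam₀ - T) T m
      ≤ coupledFreeEnergy N b x₀ lam₀ 0 m + T * (N / 2 * (1 - m) ^ 2) := by
  have h := monotoneOn_Icc_of_hasDerivAt_nonneg
    (f := fun u => u * (N / 2 * (1 - m) ^ 2)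
      - coupledFreeEnergy N b (x₀ - m * u) (lam₀ - u) u m) (l := 0) (r := T)
    ((continuous_id.mul continuous_const).sub (continuous_coupledFreeEnergy_path N b x₀ m lam₀))
    fun u hu => by
      obtain ⟨d, hd, hd'⟩ := exists_hasDerivAt_coupledFreeEnergy_path hN b lam₀ hu.1
        (trajectory_pos_or hm0 hT hu.2)
      exact ⟨1 * (N / 2 * (1 - m) ^ 2) - d, by linarith,
        ((hasDerivAt_id u).mul_const _).sub hd'⟩
  have := h (Set.left_mem_Icc.2 hT0) (Set.right_mem_Icc.2 hT0) hT0
  simp only [mul_zero, sub_zero, zero_mul, zero_sub] at this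
  linarith

/-- The gap is controlled by the effect of the coupling at time `0`. -/
theorem sub_mul_gap_le (hN : N ≠ 0) (hm0 : 0 ≤ m) (hT0 : 0 ≤ T) (hT : 0 ≤ x₀ - m * T) (lam₀ : ℝ) :
    (lam₀ - T) * gap N b x₀ m T
      ≤ T * ((2 * (N : ℝ))⁻¹ * coupledFreeEnergy N b x₀ lam₀ 0 m - alpha N b x₀ 0) := by
  have hN' : (0 : ℝ) < N := by exact_mod_cast Nat.pos_of_ne_zero hN
  set δ := (2 * (N : ℝ))⁻¹ * coupledFreeEnergy N b x₀ lam₀ 0 m - alpha N b x₀ 0 with hδ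
  have hδ' : coupledFreeEnergy N b x₀ lam₀ 0 m = 2 * N * (δ + alpha N b x₀ 0) := by
    rw [hδ]; field_simp; ring
  -- The factor `lam₀ - u` absorbs the feedback: differentiating it gives `-gap`, which cancels the
  -- `gap` in the bound on `(lam₀ - u) * gap'`.
  have h := monotoneOn_Icc_of_hasDerivAt_nonneg
    (f := fun u => u * δ - (lam₀ - u) * gap N b x₀ m u) (l := 0) (r := T)
    ((continuous_id.mul continuous_const).sub
      ((continuous_const.sub continuous_id).mul (continuous_gap N b x₀ m)))
    fun u hu => by
      refine ⟨_, ?_, ((hasDerivAt_id u).mul_const δ).sub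
        (((hasDerivAt_id u).const_sub lam₀).mul
          (hasDerivAt_gap hN b hu.1 (trajectory_pos_or hm0 hT hu.2)))⟩
      have hu' : 0 ≤ x₀ - m * u := by nlinarith [hu.1, hu.2]
      have h1 := meanSqDev_le_coupledFreeEnergy N b (x₀ - m * u) (lam₀ - u) u m
      have h2 := coupledFreeEnergy_path_le (b := b) hN hm0 hu.1.le hu' lam₀
      rw [coupledFreeEnergy_zero hN] at h1
      rw [hδ'] at h2
      have h3 : N * ((lam₀ - u) / 2 * meanSqDev N b (x₀ - m * u) u m)
          ≤ N * (2 * (δ + gap N b x₀ m u)) := by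
        unfold gap
        linarith
      have h4 := le_of_mul_le_mul_left h3 hN'
      simp only [id_eq]
      linarith
  have := h (Set.left_mem_Icc.2 hT0) (Set.right_mem_Icc.2 hT0) hT0
  simp only [gap_zero, mul_zero, sub_zero, zero_mul] at this
  linarith

end Trajectory

/-! ### The thermodynamic limit. -/

theorem start_zero {b x : ℝ} (hx : 0 ≤ x) : start b x 0 = x := by
  have h := (isGreatest_start b x 0 hx le_rfl).1.2
  rw [mul_zero, sub_zero] at h
  exact h.symm

/-- At time `0` the starting point is `x₀` itself, so the coupling in `Delta` is centred at the
slope `m` of the whole trajectory. -/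
theorem Delta_eq {b x₀ : ℝ} (hx₀ : 0 ≤ x₀) (N : ℕ) (lam₀ : ℝ) :
    Delta N b x₀ lam₀ = (2 * (N : ℝ))⁻¹ * coupledFreeEnergy N b x₀ lam₀ 0 (qbar b x₀)
      - alpha N b x₀ 0 := by
  rw [Delta, coupledAlpha_eq, qbarAt, start_zero hx₀]

/-- Below the threshold the gap vanishes in the thermodynamic limit. -/
theorem tendsto_gap {b x₀ T : ℝ} (hx₀ : 0 ≤ x₀) (hT0 : 0 ≤ T)
    (hT : 0 ≤ x₀ - qbar b x₀ * T) (hTc : (T : EReal) ≤ lambdaC b x₀) :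
    Tendsto (fun N : ℕ => gap N b x₀ (qbar b x₀) T) atTop (𝓝 0) := by
  have hm0 := qbar_nonneg b x₀
  have hm1 := qbar_le_one b x₀
  rcases hT0.eq_or_lt with rfl | hTpos
  · simp [gap_zero]
  rw [Metric.tendsto_atTop']
  intro ε hε
  -- Stopping strictly before `T` leaves room for some admissible `r > s` even when `T` equals the
  -- threshold; the time left costs at most `T - s`.
  obtain ⟨s, hs0, hsT, hsε⟩ : ∃ s, 0 ≤ s ∧ s < T ∧ T - s < ε / 2 :=
    ⟨max 0 (T - ε / 4), le_max_left _ _, max_lt hTpos (by linarith), by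
      linarith [le_max_right 0 (T - ε / 4)]⟩
  have hlt : (s : EReal) < lambdaC b x₀ := (EReal.coe_lt_coe_iff.2 hsT).trans_le hTc
  rw [lambdaC, lt_iSup_iff] at hlt
  obtain ⟨r, hr⟩ := hlt
  rw [lt_iSup_iff] at hr
  obtain ⟨hr, hsr⟩ := hr
  have hsr : s < r := EReal.coe_lt_coe_iff.1 hsr
  have hΔ : Tendsto (fun N : ℕ => s / (r - s) * Delta N b x₀ r) atTop (𝓝 0) := by
    simpa using (hr.2 r hr.1 le_rfl).const_mul (s / (r - s))
  have hev := (hΔ.eventually (gt_mem_nhds (half_pos hε))).and (eventually_ne_atTop 0)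
  obtain ⟨n, hn⟩ := eventually_atTop.1 hev
  refine ⟨n, fun N hN => ?_⟩
  obtain ⟨h1, hN0⟩ := hn N hN.le
  have h2 := gap_nonneg (b := b) hN0 hm0 hT0 hT
  have h3 := gap_le_gap_add (b := b) hN0 hm0 hm1 hT hs0 hsT.le
  have h4 := sub_mul_gap_le (b := b) (x₀ := x₀) hN0 hm0 hs0 (by nlinarith) r
  rw [← Delta_eq hx₀] at h4
  have h5 : gap N b x₀ (qbar b x₀) s ≤ s / (r - s) * Delta N b x₀ r := by
    rw [div_mul_eq_mul_div, le_div_iff₀ (sub_pos.2 hsr)]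
    linarith
  rw [Real.dist_eq, sub_zero, abs_of_nonneg h2]
  linarith

end SK

end

theorem theorem2 (b x t : ℝ) (hx : 0 ≤ x) (ht : 0 ≤ t)
    (htc : (t : EReal) ≤ SK.lambdaC b (SK.start b x t)) :
    Filter.Tendsto (fun N : ℕ => SK.alpha N b x t) Filter.atTop
      (nhds (SK.alphaBar b x t)) := by
  obtain ⟨hx₀, hstart⟩ := (SK.isGreatest_start b x t hx ht).1
  have hgap := SK.tendsto_gap hx₀ ht (hstart ▸ hx) htc
  have h := hgap.const_sub (SK.alphaBar b x t)
  rw [sub_zero] at h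
  refine h.congr' ?_
  -- For `N = 0` the normalization `N⁻¹` is `0`, and the formula for `alpha` at time `0` fails.
  filter_upwards [Filter.eventually_ne_atTop 0] with N hN
  rw [SK.gap, ← hstart, SK.alpha_zero hN, SK.alphaBar]
  ring
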